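/- Linear factor model. Fix $F$ and $T_1$. Unit $0$ is treated from period $1$ on; units $1,\dots,J$ are never treated. With $T_0$ pre-treatment periods, the outcomes of units $0,\dots,J$ are observed for $t\in\{-T_0+1,\dots,T_1\}$, where $J=J(T_0)\ge 1$; put $\mathcal T_0=\{-T_0+1,\dots,0\}$ and $\mathcal T_1=\{1,\dots,T_1\}$. Potential outcomes are $y^N_{it}=\lambda_t\mu_i+\epsilon_{it}$ and $y^I_{it}=\alpha_{it}+y^N_{it}$, with fixed factors $\lambda_t\in\mathbb R^{1\times F}$, fixed loadings $\mu_i\in\mathbb R^F$, fixed effects $\alpha_{it}$ and random shocks $\epsilon_{it}$. Observed outcomes are $y_{0t}=y^I_{0t}$ for $t\ge 1$ and $y_{it}=y^N_{it}$ otherwise; $\mathbf y_t=(y_{1t},\dots,y_{Jt})'$. Let $\Delta^{J-1}=\{w\in\mathbb R^J: w_j\ge 0,\ \sum_j w_j=1\}$, let $\mathbf M_J$ be the $J\times F$ matrix with rows $\mu_1',\dots,\mu_J'$, and let $\hat{\mathbf w}_{SC}$ be a measurable function of the pre-treatment outcomes with, almost surely, $$\hat{\mathbf w}_{SC}\in\operatorname*{argmin}_{w\in\Delta^{J-1}}\frac1{T_0}\sum_{t\in\mathcal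 T_0}(y_{0t}-w'\mathbf y_t)^2 .$$ Assume the following, where $i$ ranges over all units and $t$ over all periods $t\le T_1$, limits and $o_p(1)$ are as $T_0\to\infty$, and $J=J(T_0)$. 1. Shocks: (a) $\mathbb E[\epsilon_{it}]=0$; (b) the families $\{\epsilon_{it}\}_{t\le T_1}$ are independent across $i$; (c) for every $n$, the process $(\epsilon_{0t},\dots,\epsilon_{nt})_{t\le 0}$ is $\alpha$-mixing; (d) $\sup_{i,t}\mathbb E[\epsilon_{it}^4]<\infty$, and $\frac1{T_0}\sum_{t\in\mathcal T_0}\mathbb E[\epsilon_{0t}^2]$ converges to some $\sigma_0^2\in\mathbb R$; (e) $\inf_{i,t}\mathbb E[\epsilon_{it}^2]>0$. 2. Loadings: there are $w^*_{T_0}\in\Delta^{J(T_0)-1}$ with $\|\mathbf M_J'w^*_{T_0}-\mu_0\|_2\to 0$ and $\|w^*_{T_0}\|_2\to 0$; and $\sup_i\|\mu_i\|_2<\infty$. 3. Factors: $\frac1{T_0}\sum_{t\in\mathcal T_0}\lambda_t'\lambda_t\to\Omega$ for some positive definite $\Omega$. 4. Technical conditions: (a) $\max_{1\le j\le J}|\frac1{T_0}\sum_{t\in\mathcal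 T_0}\epsilon_{0t}\epsilon_{jt}|=o_p(1)$ and, for every $f=1,\dots,F$, $\max_{0\le j\le J}|\frac1{T_0}\sum_{t\in\mathcal T_0}\lambda_{ft}\epsilon_{jt}|=o_p(1)$; (b) for some $c>0$, $\min_{1\le j\le J}\sum_{t\in\mathcal T_0}\epsilon_{jt}^2\ge cT_0$ with probability $1-o(1)$, and $\max_{1\le i,j\le J,\ i\ne j}|\frac1{T_0}\sum_{t\in\mathcal T_0}\epsilon_{it}\epsilon_{jt}|=o_p(1)$. 5. For every unit $i$, every $t\in\mathcal T_1$ and every $T_0$, $\epsilon_{it}$ is independent of $\{\epsilon_{i\tau}\}_{\tau\in\mathcal T_0}$. Then for every $t\in\mathcal T_1$ the estimator $\hat\alpha_{0t}=y_{0t}-\mathbf y_t'\hat{\mathbf w}_{SC}$ satisfies $$\hat\alpha_{0t}\ \xrightarrow{\,p\,}\ \alpha_{0t}+\epsilon_{0t}\qquad(T_0\to\infty).$$ Moreover $\hat\alpha_{0t}$ is asymptotically unbiased for $\alpha_{0t}$: $\mathbb E[\alpha_{0t}+\epsilon_{0t}]=\alpha_{0t}$, every $\hat\alpha_{0t}$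 is integrable, and $\mathbb E[\hat\alpha_{0t}]\to\alpha_{0t}$. (No condition relates the treatment to the factors or the loadings, which are arbitrary fixed sequences apart from 2--4.) -/

import Mathlib

open MeasureTheory ProbabilityTheory Filter Topology

noncomputable section

/-- Data of a linear factor model with `F` factors. Unit `0` is treated, units `1, 2, 3, …` are the
potential controls, time is `ℤ` and treatment starts after time `0`. Loadings, factors and treatment
effects are fixed; only the idiosyncratic shocks are random. -/
structure FactorModel (F : ℕ) (Ω : Type*) where
  /-- the vector of factor loadings of unit `i` -/
  load : ℕ → EuclideanSpace ℝ (Fin F)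
  /-- the vector of common factors at time `t` -/
  factor : ℤ → EuclideanSpace ℝ (Fin F)
  /-- the idiosyncratic shock of unit `i` at time `t` -/
  shock : ℕ → ℤ → Ω → ℝ
  /-- the treatment effect of unit `i` at time `t` -/
  effect : ℕ → ℤ → ℝ

/-- The pre-treatment periods `-T₀ + 1, …, -1, 0`. -/
def prePeriods (T₀ : ℕ) : Finset ℤ := Finset.Ioc (-(T₀ : ℤ)) 0

/-- The post-treatment periods `1, …, T₁`. -/
def postPeriods (T₁ : ℕ) : Finset ℤ := Finset.Icc 1 (T₁ : ℤ)

namespace FactorModel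

section Definitions

variable {F : ℕ} {Ω : Type*}

/-- Potential outcome without treatment. -/
def outcomeN (M : FactorModel F Ω) (i : ℕ) (t : ℤ) (ω : Ω) : ℝ :=
  (∑ f, M.factor t f * M.load i f) + M.shock i t ω

/-- Potential outcome with treatment. -/
def outcomeI (M : FactorModel F Ω) (i : ℕ) (t : ℤ) (ω : Ω) : ℝ :=
  M.effect i t + M.outcomeN i t ω

/-- Treatment indicator: only unit `0` is treated, and only after time `0`. -/
def treated (i : ℕ) (t : ℤ) : ℝ := if i = 0 ∧ 0 < t then 1 else 0

/-- Observed outcome. -/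
def outcome (M : FactorModel F Ω) (i : ℕ) (t : ℤ) (ω : Ω) : ℝ :=
  treated i t * M.outcomeI i t ω + (1 - treated i t) * M.outcomeN i t ω

/-- The outcome at time `t` of the weighted average of the controls `1, …, J`;
the entry `j : Fin J` of a weight vector belongs to the unit `j + 1`. -/
def synthetic (M : FactorModel F Ω) {J : ℕ} (w : Fin J → ℝ) (t : ℤ) (ω : Ω) : ℝ :=
  ∑ j : Fin J, w j * M.outcome ((j : ℕ) + 1) t ω

/-- The factor loadings of the weighted average of the controls `1, …, J`. -/
def syntheticLoad (M : FactorModel F Ω) {J : ℕ} (w : Fin J → ℝ) : EuclideanSpace ℝ (Fin F) :=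
  ∑ j : Fin J, w j • M.load ((j : ℕ) + 1)

/-- Mean of the squared pre-treatment residuals. -/
def objective (M : FactorModel F Ω) (T₀ : ℕ) {J : ℕ} (ω : Ω) (w : Fin J → ℝ) : ℝ :=
  (1 / (T₀ : ℝ)) * ∑ t ∈ prePeriods T₀, (M.outcome 0 t ω - M.synthetic w t ω) ^ 2

/-- The σ-algebra of the pre-treatment observations of the units `0, …, J`. -/
@[reducible] def preData (M : FactorModel F Ω) (T₀ J : ℕ) : MeasurableSpace Ω :=
  ⨆ i : Fin (J + 1), ⨆ t ∈ prePeriods T₀,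
    MeasurableSpace.comap (M.outcome i t) (inferInstance : MeasurableSpace ℝ)

/-- `w` is a synthetic control weight estimator: a measurable function of the pre-treatment
observations which almost surely minimizes the mean squared pre-treatment residual over the
simplex. -/
structure IsSCWeights [MeasurableSpace Ω] (M : FactorModel F Ω) (P : Measure Ω) (T₀ J : ℕ)
    (w : Ω → Fin J → ℝ) : Prop where
  measurable_preData : Measurable[M.preData T₀ J] w
  mem_simplex : ∀ᵐ ω ∂P, w ω ∈ stdSimplex ℝ (Fin J)
  isMinOn : ∀ᵐ ω ∂P, IsMinOn (M.objective T₀ ω) (stdSimplex ℝ (Fin J)) (w ω)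

/-- The synthetic control estimator of the treatment effect at time `t`. -/
def effectEstimator (M : FactorModel F Ω) {J : ℕ} (w : Ω → Fin J → ℝ) (t : ℤ) (ω : Ω) : ℝ :=
  M.outcome 0 t ω - M.synthetic (w ω) t ω

end Definitions

end FactorModel

/-- The strong mixing (`α`-mixing) coefficient of two σ-algebras. -/
def strongMixingCoeff {Ω : Type*} {mΩ : MeasurableSpace Ω} (P : Measure Ω)
    (m₁ m₂ : MeasurableSpace Ω) : ℝ :=
  sSup {r : ℝ | ∃ A B : Set Ω, MeasurableSet[m₁] A ∧ MeasurableSet[m₂] B ∧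
    r = |P.real (A ∩ B) - P.real A * P.real B|}

/-- The process `X`, restricted to the times in `T`, is `α`-mixing. -/
def IsAlphaMixingOn {Ω S : Type*} [MeasurableSpace Ω] [mS : MeasurableSpace S] (P : Measure Ω)
    (X : ℤ → Ω → S) (T : Set ℤ) : Prop :=
  Tendsto (fun k : ℕ => ⨆ t : ℤ, strongMixingCoeff P
      (⨆ s ∈ {s | s ∈ T ∧ s ≤ t}, MeasurableSpace.comap (X s) mS)
      (⨆ s ∈ {s | s ∈ T ∧ t + (k : ℤ) ≤ s}, MeasurableSpace.comap (X s) mS))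
    atTop (𝓝 0)

namespace FactorModel

/-- Conditions on the idiosyncratic shocks, in the periods up to `T₁`. -/
structure ShockConditions {F : ℕ} {Ω : Type*} [MeasurableSpace Ω] (M : FactorModel F Ω)
    (P : Measure Ω) (T₁ : ℕ) : Prop where
  measurable : ∀ i : ℕ, ∀ t : ℤ, t ≤ T₁ → Measurable (M.shock i t)
  mean_zero : ∀ i : ℕ, ∀ t : ℤ, t ≤ T₁ → ∫ ω, M.shock i t ω ∂P = 0
  indep_units : iIndepFun (fun (i : ℕ) (ω : Ω) (t : {t : ℤ // t ≤ T₁}) => M.shock i t ω) P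
  mixing : ∀ J : ℕ,
    IsAlphaMixingOn P (fun (t : ℤ) (ω : Ω) (i : Fin (J + 1)) => M.shock i t ω) {t | t ≤ 0}
  fourth_moments : ∃ C : ℝ, ∀ i : ℕ, ∀ t : ℤ, t ≤ T₁ →
    Integrable (fun ω => M.shock i t ω ^ 4) P ∧ ∫ ω, M.shock i t ω ^ 4 ∂P ≤ C
  variance_limit : ∃ σsq : ℝ, Tendsto
    (fun T₀ : ℕ => (1 / (T₀ : ℝ)) * ∑ t ∈ prePeriods T₀, ∫ ω, M.shock 0 t ω ^ 2 ∂P)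
    atTop (𝓝 σsq)
  variance_lower : ∃ γ : ℝ, 0 < γ ∧ ∀ i : ℕ, ∀ t : ℤ, t ≤ T₁ → γ ≤ ∫ ω, M.shock i t ω ^ 2 ∂P

/-- Conditions on the factor loadings, with `J T₀` controls when there are `T₀` pre-treatment
periods: some diluted weights recover the loadings of the treated unit in the limit, and the
loadings are bounded. -/
structure LoadingConditions {F : ℕ} {Ω : Type*} (M : FactorModel F Ω) (J : ℕ → ℕ) : Prop where
  balancing : ∃ w : (T₀ : ℕ) → Fin (J T₀) → ℝ,
    (∀ T₀, w T₀ ∈ stdSimplex ℝ (Fin (J T₀))) ∧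
    Tendsto (fun T₀ => ‖M.syntheticLoad (w T₀) - M.load 0‖) atTop (𝓝 0) ∧
    Tendsto (fun T₀ => √(∑ j, w T₀ j ^ 2)) atTop (𝓝 0)
  bounded : ∃ C : ℝ, ∀ i : ℕ, ‖M.load i‖ ≤ C

/-- Condition on the common factors: the average of `λ_t' λ_t` over the pre-treatment periods tends
to a positive definite matrix. -/
def FactorConditions {F : ℕ} {Ω : Type*} (M : FactorModel F Ω) : Prop :=
  ∃ V : Matrix (Fin F) (Fin F) ℝ, V.PosDef ∧
    Tendsto (fun T₀ : ℕ => (1 / (T₀ : ℝ)) • ∑ t ∈ prePeriods T₀,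
      Matrix.of fun f g => M.factor t f * M.factor t g) atTop (𝓝 V)

/-- The high-level conditions that restrict how fast the number `J T₀` of controls may grow. -/
structure TechnicalConditions {F : ℕ} {Ω : Type*} [MeasurableSpace Ω] (M : FactorModel F Ω)
    (P : Measure Ω) (J : ℕ → ℕ) : Prop where
  treated_control : TendstoInMeasure P
    (fun (T₀ : ℕ) (ω : Ω) => ⨆ j : Fin (J T₀),
      |(1 / (T₀ : ℝ)) * ∑ t ∈ prePeriods T₀, M.shock 0 t ω * M.shock ((j : ℕ) + 1) t ω|)
    atTop (fun _ => 0)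
  factor_shock : ∀ f : Fin F, TendstoInMeasure P
    (fun (T₀ : ℕ) (ω : Ω) => ⨆ j : Fin (J T₀ + 1),
      |(1 / (T₀ : ℝ)) * ∑ t ∈ prePeriods T₀, M.factor t f * M.shock j t ω|)
    atTop (fun _ => 0)
  second_moment_lower : ∃ c : ℝ, 0 < c ∧ Tendsto
    (fun T₀ : ℕ => P {ω | ∀ j : Fin (J T₀),
      c * T₀ ≤ ∑ t ∈ prePeriods T₀, |M.shock ((j : ℕ) + 1) t ω ^ 2|}) atTop (𝓝 1)
  control_control : TendstoInMeasure P
    (fun (T₀ : ℕ) (ω : Ω) => ⨆ p : {p : Fin (J T₀) × Fin (J T₀) // p.1 ≠ p.2},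
      |(1 / (T₀ : ℝ)) * ∑ t ∈ prePeriods T₀,
        M.shock ((p.1.1 : ℕ) + 1) t ω * M.shock ((p.1.2 : ℕ) + 1) t ω|)
    atTop (fun _ => 0)

/-- For every unit, each post-treatment shock is independent of the pre-treatment shocks. -/
def PostIndependentOfPre {F : ℕ} {Ω : Type*} [MeasurableSpace Ω] (M : FactorModel F Ω)
    (P : Measure Ω) (T₁ : ℕ) : Prop :=
  ∀ i : ℕ, ∀ t ∈ postPeriods T₁, ∀ T₀ : ℕ,
    IndepFun (M.shock i t) (fun (ω : Ω) (s : {s : ℤ // s ∈ prePeriods T₀}) => M.shock i s ω) P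

end FactorModel

end

/-!
The synthetic control estimator of the treatment effect is consistent for the effect plus the shock
of the treated unit, and asymptotically unbiased, because the fitted weights balance the factor
loadings and become diluted as the number of pre-treatment periods grows.

For weights `w` in the simplex put `δ = μ₀ - ∑ j, w j • μ j`. The pre-treatment residual is
`λ_t δ + ε_{0t} - ∑ j, w j * ε_{jt}`. All the cross averages that appear when its square is expanded
are small uniformly over the units, and `w` sums to one, so the objective equals, up to an error that
is uniform in `w`, the sum of the quadratic form of `δ` in the average of `λ_t' λ_t`, a term that does
not depend on `w`, and `∑ j, w j ^ 2 * m j`, where `m j` is the mean squared shock of the control `j`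
(`abs_preMean_residual_sq_sub_le`). At the weights that the loading conditions provide, the two
terms that depend on the weights tend to zero in probability; at the minimizer they are therefore
small as well (`FactorModel.separated_le_of_isMinOn`). The quadratic form is bounded below by a
multiple of `‖δ‖ ^ 2` and each `m j` is bounded away from zero with probability tending to one, hence
`‖δ‖ ^ 2 + ∑ j, w j ^ 2` tends to zero in probability at the minimizer
(`FactorModel.tendstoInMeasure_imbalance`). It is bounded, so its expectation tends to zero too.

After the treatment the estimation error is `λ_t δ - ∑ j, w j * ε_{jt}`
(`FactorModel.effectEstimator_sub`). The weights depend on pre-treatment shocks only, and these are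
jointly independent of the post-treatment shocks of any two units
(`FactorModel.ShockConditions.indepFun_weights`). The mixed moments vanish, and the second moment of
the second term is at most a constant times the expectation of `∑ j, w j ^ 2`
(`integral_sum_mul_sq_le`). The error thus tends to zero in mean square, which gives both the
convergence in probability and the convergence of the expectations.
-/

/-! ### Pre-treatment averages and the expansion of the objective -/

/-- The average of `x` over the pre-treatment periods; it is `0` when `T₀ = 0`. -/
noncomputable def preMean (T₀ : ℕ) (x : ℤ → ℝ) : ℝ :=
  (1 / (T₀ : ℝ)) * ∑ t ∈ prePeriods T₀, x t

theorem preMean_add (T₀ : ℕ) (x y : ℤ → ℝ) :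
    preMean T₀ (fun t => x t + y t) = preMean T₀ x + preMean T₀ y := by
  simp only [preMean, Finset.sum_add_distrib, mul_add]

theorem preMean_const_mul (T₀ : ℕ) (a : ℝ) (x : ℤ → ℝ) :
    preMean T₀ (fun t => a * x t) = a * preMean T₀ x := by
  simp only [preMean, ← Finset.mul_sum]
  ring

theorem preMean_sum {ι : Type*} (T₀ : ℕ) (s : Finset ι) (x : ι → ℤ → ℝ) :
    preMean T₀ (fun t => ∑ i ∈ s, x i t) = ∑ i ∈ s, preMean T₀ (x i) := by
  simp only [preMean]
  rw [Finset.sum_comm, Finset.mul_sum]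

theorem preMean_le_of_le {T₀ : ℕ} {x : ℤ → ℝ} {C : ℝ} (hC : 0 ≤ C)
    (h : ∀ t ∈ prePeriods T₀, x t ≤ C) : preMean T₀ x ≤ C := by
  rcases Nat.eq_zero_or_pos T₀ with rfl | hT
  · simpa [preMean] using hC
  have hT' : (0 : ℝ) < T₀ := by exact_mod_cast hT
  have hsum : ∑ t ∈ prePeriods T₀, x t ≤ T₀ * C := by
    refine (Finset.sum_le_card_nsmul _ _ _ h).trans_eq ?_
    simp [prePeriods]
  rw [preMean, one_div, inv_mul_le_iff₀ hT']
  exact hsum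

theorem abs_sum_simplex_mul_le {ι : Type*} [Fintype ι] {w : ι → ℝ} (hw : w ∈ stdSimplex ℝ ι)
    {q : ι → ℝ} {a : ℝ} (hq : ∀ j, |q j| ≤ a) : |∑ j, w j * q j| ≤ a := by
  calc |∑ j, w j * q j| ≤ ∑ j, |w j * q j| := Finset.abs_sum_le_sum_abs _ _
    _ ≤ ∑ j, w j * a := by
        refine Finset.sum_le_sum fun j _ => ?_
        rw [abs_mul, abs_of_nonneg (hw.1 j)]
        exact mul_le_mul_of_nonneg_left (hq j) (hw.1 j)
    _ = a := by rw [← Finset.sum_mul, hw.2, one_mul]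

theorem sum_sq_le_one_of_mem_stdSimplex {ι : Type*} [Fintype ι] {w : ι → ℝ}
    (hw : w ∈ stdSimplex ℝ ι) : ∑ j, w j ^ 2 ≤ 1 := by
  calc ∑ j, w j ^ 2 ≤ ∑ j, w j := by
        refine Finset.sum_le_sum fun j _ => ?_
        have h1 : w j ≤ 1 := by
          rw [← hw.2]
          exact Finset.single_le_sum (f := w) (fun i _ => hw.1 i) (Finset.mem_univ j)
        nlinarith [hw.1 j]
    _ = 1 := hw.2

/-- If the cross averages of the factors, the shock `e₀` and the shocks `e j` are small, then the
mean squared residual separates, up to an error that does not depend on the weights, into a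
quadratic form in the loading gap `δ`, a constant, and a weighted sum of squared weights. -/
theorem abs_preMean_residual_sq_sub_le {ι κ : Type*} [Fintype ι] [DecidableEq ι] [Fintype κ]
    (T₀ : ℕ) (l : κ → ℤ → ℝ) (e₀ : ℤ → ℝ) (e : ι → ℤ → ℝ) {w : ι → ℝ} (hw : w ∈ stdSimplex ℝ ι)
    (δ : κ → ℝ) {D a b c : ℝ} (hD : ∀ f, |δ f| ≤ D) (hc0 : 0 ≤ c)
    (ha : ∀ j, |preMean T₀ fun t => e₀ t * e j t| ≤ a)
    (hb₀ : ∀ f, |preMean T₀ fun t => l f t * e₀ t| ≤ b)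
    (hb : ∀ f j, |preMean T₀ fun t => l f t * e j t| ≤ b)
    (hc : ∀ i j, i ≠ j → |preMean T₀ fun t => e i t * e j t| ≤ c) :
    |preMean T₀ (fun t => (∑ f, δ f * l f t + e₀ t - ∑ j, w j * e j t) ^ 2)
      - (preMean T₀ (fun t => (∑ f, δ f * l f t) ^ 2) + preMean T₀ (fun t => e₀ t ^ 2)
        + ∑ j, w j ^ 2 * preMean T₀ fun t => e j t ^ 2)|
      ≤ 4 * (Fintype.card κ * D * b) + 2 * a + c := by
  -- the factor part is almost orthogonal to each shock
  have hx : ∀ u : ℤ → ℝ, (∀ f, |preMean T₀ fun t => l f t * u t| ≤ b) →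
      |preMean T₀ fun t => (∑ f, δ f * l f t) * u t| ≤ Fintype.card κ * D * b := by
    intro u hu
    have h1 : (fun t => (∑ f, δ f * l f t) * u t) = fun t => ∑ f, δ f * (l f t * u t) := by
      funext t
      rw [Finset.sum_mul]
      exact Finset.sum_congr rfl fun f _ => by ring
    rw [h1, preMean_sum]
    simp only [preMean_const_mul]
    calc |∑ f, δ f * preMean T₀ fun t => l f t * u t|
        ≤ ∑ f, |δ f * preMean T₀ fun t => l f t * u t| := Finset.abs_sum_le_sum_abs _ _
      _ ≤ ∑ _f : κ, D * b := by
          refine Finset.sum_le_sum fun f _ => ?_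
          rw [abs_mul]
          exact mul_le_mul (hD f) (hu f) (abs_nonneg _) ((abs_nonneg _).trans (hD f))
      _ = Fintype.card κ * D * b := by simp [mul_assoc]
  -- averages against the synthetic shock are convex combinations
  have hlin : ∀ y : ℤ → ℝ, preMean T₀ (fun t => y t * ∑ j, w j * e j t)
      = ∑ j, w j * preMean T₀ fun t => y t * e j t := by
    intro y
    have h1 : (fun t => y t * ∑ j, w j * e j t) = fun t => ∑ j, w j * (y t * e j t) := by
      funext t
      rw [Finset.mul_sum]
      exact Finset.sum_congr rfl fun f _ => by ring
    rw [h1, preMean_sum]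
    simp only [preMean_const_mul]
  set x : ℤ → ℝ := fun t => ∑ f, δ f * l f t with hxdef
  set u : ℤ → ℝ := fun t => ∑ j, w j * e j t with hudef
  have h1 : |preMean T₀ fun t => x t * e₀ t| ≤ Fintype.card κ * D * b := hx e₀ hb₀
  have h2 : |preMean T₀ fun t => x t * u t| ≤ Fintype.card κ * D * b := by
    rw [hlin x]
    exact abs_sum_simplex_mul_le hw fun j => hx (e j) fun f => hb f j
  have h3 : |preMean T₀ fun t => e₀ t * u t| ≤ a := by
    rw [hlin e₀]
    exact abs_sum_simplex_mul_le hw ha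
  have h4 : |preMean T₀ (fun t => u t ^ 2) - ∑ j, w j ^ 2 * preMean T₀ fun t => e j t ^ 2| ≤ c := by
    have h5 : preMean T₀ (fun t => u t ^ 2) - ∑ j, w j ^ 2 * preMean T₀ (fun t => e j t ^ 2)
        = ∑ j, w j * ∑ i, w i *
          ((preMean T₀ fun t => e i t * e j t) - if i = j then preMean T₀ fun t => e j t ^ 2 else 0)
        := by
      have h6 : preMean T₀ (fun t => u t ^ 2) = ∑ j, w j * preMean T₀ fun t => u t * e j t := by
        rw [← hlin u]
        simp only [sq, hudef]
      rw [h6, ← Finset.sum_sub_distrib]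
      refine Finset.sum_congr rfl fun j _ => ?_
      have h7 : preMean T₀ (fun t => u t * e j t) = ∑ i, w i * preMean T₀ fun t => e i t * e j t := by
        have := hlin (e j)
        simp only [mul_comm (e j _)] at this
        simpa only [hudef] using this
      rw [h7]
      simp only [mul_sub, Finset.sum_sub_distrib, mul_ite, mul_zero, Finset.sum_ite_eq',
        Finset.mem_univ, if_true]
      ring
    rw [h5]
    refine abs_sum_simplex_mul_le hw fun j => abs_sum_simplex_mul_le hw fun i => ?_
    by_cases hij : i = j
    · subst hij
      simpa [sq] using hc0
    · simpa [hij] using hc i j hij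
  have hexp : preMean T₀ (fun t => (x t + e₀ t - u t) ^ 2)
      = preMean T₀ (fun t => x t ^ 2) + preMean T₀ (fun t => e₀ t ^ 2)
        + preMean T₀ (fun t => u t ^ 2) + 2 * (preMean T₀ fun t => x t * e₀ t)
        + (-2) * (preMean T₀ fun t => x t * u t) + (-2) * (preMean T₀ fun t => e₀ t * u t) := by
    simp only [← preMean_const_mul, ← preMean_add]
    congr 1
    funext t
    ring
  rw [hexp]
  rw [abs_le] at *
  constructor <;> linarith [h1.1, h1.2, h2.1, h2.2, h3.1, h3.2, h4.1, h4.2]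

/-! ### Quadratic forms of a convergent sequence of matrices -/

theorem preMean_factor_sq {κ : Type*} [Fintype κ] (T₀ : ℕ) (l : κ → ℤ → ℝ) (δ : κ → ℝ) :
    preMean T₀ (fun t => (∑ f, δ f * l f t) ^ 2)
      = ∑ f, ∑ g, δ f * δ g * preMean T₀ fun t => l f t * l g t := by
  simp only [← preMean_const_mul, ← preMean_sum]
  congr 1
  funext t
  rw [sq, Finset.sum_mul_sum]
  exact Finset.sum_congr rfl fun f _ => Finset.sum_congr rfl fun g _ => by ring

theorem Matrix.PosDef.exists_pos_mul_sum_sq_le {κ : Type*} [Fintype κ] {V : Matrix κ κ ℝ}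
    (hV : V.PosDef) : ∃ k : ℝ, 0 < k ∧ ∀ x : κ → ℝ,
      k * ∑ f, x f ^ 2 ≤ ∑ f, ∑ g, x f * x g * V f g := by
  classical
  have hpos : ∀ x : κ → ℝ, x ≠ 0 → 0 < ∑ f, ∑ g, x f * x g * V f g := by
    intro x hx
    have h := hV.dotProduct_mulVec_pos hx
    refine h.trans_eq ?_
    simp only [dotProduct, Matrix.mulVec, Finset.mul_sum, star_trivial]
    exact Finset.sum_congr rfl fun f _ => Finset.sum_congr rfl fun g _ => by ring
  rcases isEmpty_or_nonempty κ with hκ | hκ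
  · exact ⟨1, one_pos, fun x => by simp⟩
  let q : EuclideanSpace ℝ κ → ℝ := fun x => ∑ f, ∑ g, x f * x g * V f g
  have hq : Continuous q := by fun_prop
  obtain ⟨x₀, hx₀, hmin⟩ := (isCompact_sphere (0 : EuclideanSpace ℝ κ) 1).exists_isMinOn
    (NormedSpace.sphere_nonempty.2 zero_le_one) hq.continuousOn
  have hx₀' : ‖x₀‖ = 1 := by simpa using hx₀
  refine ⟨q x₀, hpos _ ?_, fun x => ?_⟩
  · intro h
    have : x₀ = 0 := by ext i; exact congrFun h i
    rw [this] at hx₀'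
    simp at hx₀'
  by_cases hx : x = 0
  · simp [hx]
  -- both sides are homogeneous of degree two, so it suffices to compare on the unit sphere
  let y : EuclideanSpace ℝ κ := WithLp.toLp 2 x
  have hy : y ≠ 0 := by
    intro h
    exact hx (funext fun i => congrArg (fun z : EuclideanSpace ℝ κ => z i) h)
  have hny : 0 < ‖y‖ := norm_pos_iff.2 hy
  have hmem : ‖y‖⁻¹ • y ∈ Metric.sphere (0 : EuclideanSpace ℝ κ) 1 := by
    simp [norm_smul, hny.ne']
  have hle : q x₀ ≤ q (‖y‖⁻¹ • y) := hmin hmem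
  have hscale : q (‖y‖⁻¹ • y) * ‖y‖ ^ 2 = ∑ f, ∑ g, x f * x g * V f g := by
    simp only [q, Finset.sum_mul]
    refine Finset.sum_congr rfl fun f _ => Finset.sum_congr rfl fun g _ => ?_
    have : (‖y‖⁻¹ • y) f = ‖y‖⁻¹ * x f := rfl
    rw [this]
    have : (‖y‖⁻¹ • y) g = ‖y‖⁻¹ * x g := rfl
    rw [this]
    field_simp
  have hnorm : ‖y‖ ^ 2 = ∑ f, x f ^ 2 := by
    rw [EuclideanSpace.norm_sq_eq]
    simp [y]
  rw [← hscale, ← hnorm]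
  exact mul_le_mul_of_nonneg_right hle (by positivity)

theorem abs_sum_sum_mul_le {κ : Type*} [Fintype κ] {A : κ → κ → ℝ} {η : ℝ}
    (hA : ∀ f g, |A f g| ≤ η) (x : κ → ℝ) :
    |∑ f, ∑ g, x f * x g * A f g| ≤ η * Fintype.card κ * ∑ f, x f ^ 2 := by
  have hterm : ∀ f g, |x f * x g * A f g| ≤ η * ((x f ^ 2 + x g ^ 2) / 2) := by
    intro f g
    rw [abs_mul, mul_comm]
    have h1 : |x f * x g| ≤ (x f ^ 2 + x g ^ 2) / 2 := by
      rw [abs_le]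
      constructor <;> nlinarith [sq_nonneg (x f + x g), sq_nonneg (x f - x g)]
    exact mul_le_mul (hA f g) h1 (abs_nonneg _) ((abs_nonneg _).trans (hA f g))
  calc |∑ f, ∑ g, x f * x g * A f g| ≤ ∑ f, ∑ g, |x f * x g * A f g| :=
        (Finset.abs_sum_le_sum_abs _ _).trans
          (Finset.sum_le_sum fun f _ => Finset.abs_sum_le_sum_abs _ _)
    _ ≤ ∑ f, ∑ g, η * ((x f ^ 2 + x g ^ 2) / 2) :=
        Finset.sum_le_sum fun f _ => Finset.sum_le_sum fun g _ => hterm f g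
    _ = η * Fintype.card κ * ∑ f, x f ^ 2 := by
        simp only [← Finset.mul_sum, ← Finset.sum_div, Finset.sum_add_distrib, Finset.sum_const,
          Finset.card_univ, nsmul_eq_mul]
        ring

/-- The quadratic forms of matrices that tend to a positive definite matrix are eventually bounded
below and above by positive multiples of the squared norm. -/
theorem Matrix.PosDef.eventually_quadratic_bounds {κ : Type*} [Fintype κ] {V : Matrix κ κ ℝ}
    (hV : V.PosDef) {A : ℕ → Matrix κ κ ℝ} (hA : Tendsto A atTop (𝓝 V)) :
    ∃ k K : ℝ, 0 < k ∧ 0 ≤ K ∧ ∀ᶠ n in atTop, ∀ x : κ → ℝ,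
      k * ∑ f, x f ^ 2 ≤ ∑ f, ∑ g, x f * x g * A n f g ∧
      ∑ f, ∑ g, x f * x g * A n f g ≤ K * ∑ f, x f ^ 2 := by
  classical
  obtain ⟨k, hk, hkV⟩ := hV.exists_pos_mul_sum_sq_le
  -- entrywise errors of size `η` change the quadratic form by at most `η * card κ * ∑ f, x f ^ 2`
  set η : ℝ := k / (2 * (Fintype.card κ + 1)) with hη
  have hη0 : 0 < η := by positivity
  have hηk : η * Fintype.card κ ≤ k / 2 := by
    rw [hη, div_mul_eq_mul_div, div_le_div_iff₀ (by positivity) (by positivity)]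
    nlinarith
  set m : ℝ := ∑ f, ∑ g, |V f g| with hm
  have hVm : ∀ f g, |V f g| ≤ m := fun f g =>
    (Finset.single_le_sum (f := fun g => |V f g|) (fun _ _ => abs_nonneg _)
      (Finset.mem_univ g)).trans
    (Finset.single_le_sum (f := fun f => ∑ g, |V f g|)
      (fun _ _ => Finset.sum_nonneg fun _ _ => abs_nonneg _) (Finset.mem_univ f))
  have hm0 : 0 ≤ m := Finset.sum_nonneg fun _ _ => Finset.sum_nonneg fun _ _ => abs_nonneg _
  refine ⟨k / 2, m * Fintype.card κ + k / 2, by positivity, by positivity, ?_⟩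
  have hev : ∀ᶠ n in atTop, ∀ f g, |A n f g - V f g| ≤ η := by
    refine eventually_all.2 fun f => eventually_all.2 fun g => ?_
    have h1 : Tendsto (fun n => A n f g) atTop (𝓝 (V f g)) :=
      tendsto_pi_nhds.1 (tendsto_pi_nhds.1 hA f) g
    filter_upwards [(Metric.tendsto_nhds.1 h1) η hη0] with n hn
    rw [Real.dist_eq] at hn
    exact hn.le
  filter_upwards [hev] with n hn x
  have h1 := abs_sum_sum_mul_le hn x
  have h2 := abs_sum_sum_mul_le hVm x
  have h3 := hkV x
  have hs : 0 ≤ ∑ f, x f ^ 2 := Finset.sum_nonneg fun _ _ => sq_nonneg _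
  have h4 : ∑ f, ∑ g, x f * x g * (A n f g - V f g)
      = ∑ f, ∑ g, x f * x g * A n f g - ∑ f, ∑ g, x f * x g * V f g := by
    simp only [mul_sub, Finset.sum_sub_distrib]
  have h5 := mul_le_mul_of_nonneg_right hηk hs
  rw [h4, abs_le] at h1
  rw [abs_le] at h2
  constructor <;> nlinarith [h1.1, h1.2, h2.1, h2.2]

/-! ### Convergence to zero in probability -/

section InProbability

variable {Ω : Type*} [MeasurableSpace Ω] {P : Measure Ω}

theorem tendstoInMeasure_zero_iff {X : ℕ → Ω → ℝ} :
    TendstoInMeasure P X atTop (fun _ => 0) ↔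
      ∀ ε, 0 < ε → Tendsto (fun n => P {ω | ε ≤ |X n ω|}) atTop (𝓝 0) := by
  simp [tendstoInMeasure_iff_norm, Real.norm_eq_abs]

/-- Domination outside of sets whose probability tends to zero. -/
theorem tendstoInMeasure_zero_of_le {X Y : ℕ → Ω → ℝ} {B : ℕ → Set Ω}
    (hY : TendstoInMeasure P Y atTop (fun _ => 0)) (hB : Tendsto (fun n => P (B n)) atTop (𝓝 0))
    (h : ∀ᶠ n in atTop, ∀ ω, ω ∉ B n → |X n ω| ≤ |Y n ω|) :
    TendstoInMeasure P X atTop (fun _ => 0) := by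
  rw [tendstoInMeasure_zero_iff] at hY ⊢
  intro ε hε
  have hsum : Tendsto (fun n => P {ω | ε ≤ |Y n ω|} + P (B n)) atTop (𝓝 0) := by
    simpa using (hY ε hε).add hB
  refine tendsto_of_tendsto_of_tendsto_of_le_of_le' tendsto_const_nhds hsum
    (Eventually.of_forall fun _ => zero_le) ?_
  filter_upwards [h] with n hn
  refine (measure_mono fun ω hω => ?_).trans (measure_union_le _ _)
  by_cases hB' : ω ∈ B n
  · exact Or.inr hB'
  · exact Or.inl (le_trans hω (hn ω hB'))

theorem tendstoInMeasure_zero_add {X Y : ℕ → Ω → ℝ}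
    (hX : TendstoInMeasure P X atTop (fun _ => 0)) (hY : TendstoInMeasure P Y atTop (fun _ => 0)) :
    TendstoInMeasure P (fun n ω => X n ω + Y n ω) atTop (fun _ => 0) := by
  rw [tendstoInMeasure_zero_iff] at *
  intro ε hε
  have hsum := (hX (ε / 2) (half_pos hε)).add (hY (ε / 2) (half_pos hε))
  rw [add_zero] at hsum
  refine tendsto_of_tendsto_of_tendsto_of_le_of_le tendsto_const_nhds hsum
    (fun _ => zero_le) fun n => ?_
  refine (measure_mono fun ω hω => ?_).trans (measure_union_le _ _)
  by_contra hcon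
  simp only [Set.mem_union, Set.mem_ofPred_eq, not_or, not_le] at hcon hω
  linarith [abs_add_le (X n ω) (Y n ω), hcon.1, hcon.2]

theorem tendstoInMeasure_zero_const_mul {X : ℕ → Ω → ℝ} (a : ℝ)
    (hX : TendstoInMeasure P X atTop (fun _ => 0)) :
    TendstoInMeasure P (fun n ω => a * X n ω) atTop (fun _ => 0) := by
  rw [tendstoInMeasure_zero_iff] at *
  intro ε hε
  refine tendsto_of_tendsto_of_tendsto_of_le_of_le tendsto_const_nhds
    (hX (ε / (|a| + 1)) (by positivity)) (fun _ => zero_le) fun n => measure_mono fun ω hω => ?_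
  simp only [Set.mem_ofPred_eq, abs_mul] at hω ⊢
  rw [div_le_iff₀ (by positivity)]
  nlinarith [abs_nonneg (X n ω), abs_nonneg a]

theorem tendstoInMeasure_zero_sum {ι : Type*} (s : Finset ι) {X : ι → ℕ → Ω → ℝ}
    (hX : ∀ i ∈ s, TendstoInMeasure P (X i) atTop (fun _ => 0)) :
    TendstoInMeasure P (fun n ω => ∑ i ∈ s, X i n ω) atTop (fun _ => 0) := by
  classical
  induction s using Finset.induction_on with
  | empty =>
    simp only [Finset.sum_empty]
    rw [tendstoInMeasure_zero_iff]
    intro ε hε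
    simp [hε.not_ge]
  | insert i s hi ih =>
    simp only [Finset.sum_insert hi]
    exact tendstoInMeasure_zero_add (hX i (Finset.mem_insert_self i s))
      (ih fun j hj => hX j (Finset.mem_insert_of_mem hj))

theorem tendstoInMeasure_zero_of_const {s : ℕ → ℝ} (hs : Tendsto s atTop (𝓝 0)) :
    TendstoInMeasure P (fun n (_ : Ω) => s n) atTop (fun _ => 0) := by
  rw [tendstoInMeasure_zero_iff]
  intro ε hε
  refine tendsto_const_nhds.congr' ?_
  filter_upwards [(Metric.tendsto_nhds.1 hs) ε hε] with n hn
  rw [Real.dist_eq, sub_zero] at hn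
  simp [hn.not_ge]

theorem tendstoInMeasure_zero_of_integral [IsProbabilityMeasure P] {X : ℕ → Ω → ℝ}
    (h0 : ∀ n ω, 0 ≤ X n ω) (hint : ∀ n, Integrable (X n) P)
    (hlim : Tendsto (fun n => ∫ ω, X n ω ∂P) atTop (𝓝 0)) :
    TendstoInMeasure P X atTop (fun _ => 0) := by
  rw [tendstoInMeasure_iff_measureReal_norm]
  intro ε hε
  have hlim' : Tendsto (fun n => ε⁻¹ * ∫ ω, X n ω ∂P) atTop (𝓝 0) := by
    simpa using hlim.const_mul ε⁻¹
  refine tendsto_of_tendsto_of_tendsto_of_le_of_le tendsto_const_nhds hlim'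
    (fun _ => measureReal_nonneg) fun n => ?_
  have h := mul_meas_ge_le_integral_of_nonneg (Eventually.of_forall (h0 n)) (hint n) ε
  simp only [sub_zero, Real.norm_eq_abs, abs_of_nonneg (h0 n _)]
  rw [le_inv_mul_iff₀ hε]
  exact h

/-- Bounded convergence for sequences that tend to zero in probability. -/
theorem tendsto_integral_of_tendstoInMeasure_zero [IsProbabilityMeasure P] {X : ℕ → Ω → ℝ} {K : ℝ}
    (hX : TendstoInMeasure P X atTop (fun _ => 0)) (hm : ∀ n, Measurable (X n))
    (h0 : ∀ n ω, 0 ≤ X n ω) (hK : ∀ n, ∀ᵐ ω ∂P, X n ω ≤ K) :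
    Tendsto (fun n => ∫ ω, X n ω ∂P) atTop (𝓝 0) := by
  have hK0 : 0 ≤ K := by
    obtain ⟨ω, hω⟩ := (hK 0).exists
    exact (h0 0 ω).trans hω
  rw [tendstoInMeasure_iff_measureReal_norm] at hX
  have hbound : ∀ ε > 0, ∀ n, ∫ ω, X n ω ∂P ≤ ε + K * P.real {ω | ε ≤ X n ω} := by
    intro ε hε n
    have hset : MeasurableSet {ω | ε ≤ X n ω} := measurableSet_le measurable_const (hm n)
    calc ∫ ω, X n ω ∂P ≤ ∫ ω, (ε + {ω | ε ≤ X n ω}.indicator (fun _ => K) ω) ∂P := by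
          refine integral_mono_of_nonneg (Eventually.of_forall (h0 n))
            ((integrable_const _).add ((integrable_const _).indicator hset)) ?_
          filter_upwards [hK n] with ω hω
          by_cases h : ε ≤ X n ω
          · simp only [Set.indicator, Set.mem_ofPred_eq, h, if_true]
            linarith
          · simp only [Set.indicator, Set.mem_ofPred_eq, h, if_false]
            linarith [not_le.1 h]
      _ = ε + K * P.real {ω | ε ≤ X n ω} := by
          rw [integral_add (integrable_const _) ((integrable_const _).indicator hset),
            integral_indicator_const _ hset]
          simp [mul_comm]
  rw [Metric.tendsto_atTop']
  intro ε hε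
  have h1 := (hX (ε / 2) (half_pos hε)).const_mul K
  rw [mul_zero] at h1
  obtain ⟨N, hN⟩ := eventually_atTop.1 ((Metric.tendsto_nhds.1 h1) (ε / 2) (half_pos hε))
  refine ⟨N, fun n hn => ?_⟩
  have h2 := hN n hn.le
  simp only [sub_zero, Real.norm_eq_abs, abs_of_nonneg (h0 n _)] at h2
  rw [Real.dist_eq, sub_zero, abs_of_nonneg (mul_nonneg hK0 measureReal_nonneg)] at h2
  rw [Real.dist_eq, sub_zero, abs_of_nonneg (integral_nonneg (h0 n))]
  linarith [hbound (ε / 2) (half_pos hε) n]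

/-- A random variable with a small second moment has a small mean. -/
theorem tendsto_integral_of_tendsto_integral_sq [IsProbabilityMeasure P] {X : ℕ → Ω → ℝ}
    (hX : ∀ n, MemLp (X n) 2 P) (hlim : Tendsto (fun n => ∫ ω, X n ω ^ 2 ∂P) atTop (𝓝 0)) :
    Tendsto (fun n => ∫ ω, X n ω ∂P) atTop (𝓝 0) := by
  have hsq : Tendsto (fun n => (∫ ω, X n ω ∂P) ^ 2) atTop (𝓝 0) := by
    refine tendsto_of_tendsto_of_tendsto_of_le_of_le tendsto_const_nhds hlim
      (fun _ => sq_nonneg _) fun n => ?_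
    have h := variance_nonneg (X n) P
    rw [variance_eq_sub (hX n)] at h
    simpa using h
  have h := hsq.sqrt
  simp only [Real.sqrt_sq_eq_abs, Real.sqrt_zero] at h
  exact (tendsto_zero_iff_abs_tendsto_zero _).2 h

theorem tendstoInMeasure_zero_of_tendsto_integral_sq [IsProbabilityMeasure P] {X : ℕ → Ω → ℝ}
    (hX : ∀ n, MemLp (X n) 2 P) (hlim : Tendsto (fun n => ∫ ω, X n ω ^ 2 ∂P) atTop (𝓝 0)) :
    TendstoInMeasure P X atTop (fun _ => 0) := by
  have h := tendstoInMeasure_zero_of_integral (fun n ω => sq_nonneg (X n ω))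
    (fun n => (hX n).integrable_sq) hlim
  rw [tendstoInMeasure_zero_iff] at h ⊢
  intro ε hε
  refine (h (ε ^ 2) (by positivity)).congr fun n => ?_
  congr 1
  ext ω
  simp only [Set.mem_ofPred_eq, abs_pow]
  exact pow_le_pow_iff_left₀ hε.le (abs_nonneg _) two_ne_zero

end InProbability

/-! ### Weights that are independent of the shocks they are applied to -/

section Independence

variable {Ω : Type*} [MeasurableSpace Ω] {P : Measure Ω}

/-- Two independent variables form an independent family indexed by `Bool`. -/
theorem IndepFun.iIndepFun_bool {β : Bool → Type*} [∀ b, MeasurableSpace (β b)]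
    {X : (b : Bool) → Ω → β b} [IsProbabilityMeasure P] (h : IndepFun (X true) (X false) P) :
    iIndepFun X P := by
  rw [iIndepFun_iff_measure_inter_preimage_eq_mul]
  intro S A hA
  by_cases h1 : true ∈ S <;> by_cases h0 : false ∈ S
  · have hS : S = {true, false} := by
      ext b; cases b <;> simp [h1, h0]
    rw [hS, Finset.prod_pair (by decide), Finset.set_biInter_insert, Finset.set_biInter_singleton]
    exact h.measure_inter_preimage_eq_mul _ _ (hA true h1) (hA false h0)
  · have hS : S = {true} := by
      ext b; cases b <;> simp [h1, h0]
    subst hS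
    simp
  · have hS : S = {false} := by
      ext b; cases b <;> simp [h1, h0]
    subst hS
    simp
  · have hS : S = ∅ := by
      ext b; cases b <;> simp [h1, h0]
    subst hS
    simp

/-- If the weights `v` are bounded and independent of each pair of the centred, pairwise
uncorrelated variables `Y j`, then the second moment of `∑ j, v j * Y j` is governed by the
expected sum of squared weights. -/
theorem integral_sum_mul_sq_le {ι : Type*} [Fintype ι] [IsProbabilityMeasure P]
    {v : Ω → ι → ℝ} {Y : ι → Ω → ℝ} {C : ℝ} (hv : Measurable v)
    (hv1 : ∀ᵐ ω ∂P, ∀ j, |v ω j| ≤ 1) (hY : ∀ j, MemLp (Y j) 2 P)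
    (hYm : ∀ j, Measurable (Y j))
    (hindep : ∀ i j, IndepFun v (fun ω => (Y i ω, Y j ω)) P)
    (huncorr : ∀ i j, i ≠ j → ∫ ω, Y i ω * Y j ω ∂P = 0)
    (hC : ∀ j, ∫ ω, Y j ω ^ 2 ∂P ≤ C) :
    MemLp (fun ω => ∑ j, v ω j * Y j ω) 2 P ∧
      ∫ ω, (∑ j, v ω j * Y j ω) ^ 2 ∂P ≤ C * ∫ ω, ∑ j, v ω j ^ 2 ∂P := by
  classical
  have hvm : ∀ j, Measurable fun ω => v ω j := fun j => (measurable_pi_apply j).comp hv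
  have hbd : ∀ j, ∀ᵐ ω ∂P, ‖v ω j‖ ≤ 1 := fun j => by
    filter_upwards [hv1] with ω hω using hω j
  have hvY : ∀ j, MemLp (fun ω => v ω j * Y j ω) 2 P := by
    intro j
    refine (hY j).of_le ((hvm j).mul (hYm j)).aestronglyMeasurable ?_
    filter_upwards [hbd j] with ω hω
    rw [norm_mul]
    exact mul_le_of_le_one_left (norm_nonneg _) hω
  have hprod : ∀ i j, Integrable (fun ω => v ω i * Y i ω * (v ω j * Y j ω)) P :=
    fun i j => (hvY i).integrable_mul (hvY j)
  have hvsq : ∀ j, Integrable (fun ω => v ω j ^ 2) P := by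
    intro j
    refine Integrable.of_bound ((hvm j).pow_const 2).aestronglyMeasurable 1 ?_
    filter_upwards [hbd j] with ω hω
    rw [norm_pow]
    exact pow_le_one₀ (norm_nonneg _) hω
  refine ⟨memLp_finsetSum _ fun j _ => hvY j, ?_⟩
  -- independence of `v` and `(Y i, Y j)` makes the mixed moments factor
  have hfactor : ∀ i j, ∫ ω, v ω i * Y i ω * (v ω j * Y j ω) ∂P
      = (∫ ω, v ω i * v ω j ∂P) * ∫ ω, Y i ω * Y j ω ∂P := by
    intro i j
    rw [← (hindep i j).integral_fun_comp_mul_comp (f := fun x => x i * x j)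
      (g := fun y => y.1 * y.2) hv.aemeasurable ((hYm i).prodMk (hYm j)).aemeasurable
      (by fun_prop) (by fun_prop)]
    congr 1
    funext ω
    ring
  calc ∫ ω, (∑ j, v ω j * Y j ω) ^ 2 ∂P
      = ∫ ω, ∑ i, ∑ j, v ω i * Y i ω * (v ω j * Y j ω) ∂P := by
        simp only [sq, Finset.sum_mul_sum]
    _ = ∑ i, ∑ j, ∫ ω, v ω i * Y i ω * (v ω j * Y j ω) ∂P := by
        rw [integral_finsetSum _ fun i _ => integrable_finsetSum _ fun j _ => hprod i j]
        exact Finset.sum_congr rfl fun i _ => integral_finsetSum _ fun j _ => hprod i j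
    _ = ∑ i, (∫ ω, v ω i ^ 2 ∂P) * ∫ ω, Y i ω ^ 2 ∂P := by
        refine Finset.sum_congr rfl fun i _ => ?_
        rw [Finset.sum_eq_single i]
        · rw [hfactor]
          simp only [sq]
        · intro j _ hj
          rw [hfactor, huncorr i j hj.symm, mul_zero]
        · simp
    _ ≤ ∑ i, (∫ ω, v ω i ^ 2 ∂P) * C :=
        Finset.sum_le_sum fun i _ =>
          mul_le_mul_of_nonneg_left (hC i) (integral_nonneg fun _ => sq_nonneg _)
    _ = C * ∫ ω, ∑ j, v ω j ^ 2 ∂P := by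
        rw [integral_finsetSum _ fun j _ => hvsq j, ← Finset.sum_mul, mul_comm]

end Independence

namespace FactorModel

variable {F : ℕ} {Ω : Type*} [MeasurableSpace Ω] {P : Measure Ω} {M : FactorModel F Ω} {T₁ : ℕ}

theorem le_of_mem_prePeriods {T₀ : ℕ} {s : ℤ} (hs : s ∈ prePeriods T₀) (T₁ : ℕ) : s ≤ T₁ := by
  simp only [prePeriods, Finset.mem_Ioc] at hs
  omega

theorem le_of_mem_postPeriods {t : ℤ} (ht : t ∈ postPeriods T₁) : t ≤ T₁ :=
  (Finset.mem_Icc.1 ht).2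

/-- The path of the shocks of unit `i` split into two parts: the pre-treatment shocks (index
`true`, set to zero at all other times) and the shock at time `t` (index `false`, repeated at every
time so that both parts live in the same space). -/
noncomputable def splitShock (M : FactorModel F Ω) (T₀ : ℕ) (t : ℤ) (i : ℕ) (b : Bool) (ω : Ω) (s : ℤ) : ℝ :=
  if b then if s ∈ prePeriods T₀ then M.shock i s ω else 0 else M.shock i t ω

theorem ShockConditions.measurable_splitShock (h : M.ShockConditions P T₁) (T₀ : ℕ) {t : ℤ}
    (ht : t ≤ T₁) (i : ℕ) (b : Bool) : Measurable (M.splitShock T₀ t i b) := by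
  refine measurable_pi_lambda _ fun s => ?_
  cases b
  · simpa [splitShock] using h.measurable i t ht
  · by_cases hs : s ∈ prePeriods T₀
    · simpa [splitShock, hs] using h.measurable i s (le_of_mem_prePeriods hs T₁)
    · simp [splitShock, hs]

/-- Independence across units and, within each unit, of the two parts of the path gives joint
independence of all the parts. -/
theorem ShockConditions.iIndepFun_splitShock [IsProbabilityMeasure P]
    (h : M.ShockConditions P T₁) (hpost : M.PostIndependentOfPre P T₁) (T₀ : ℕ) {t : ℤ}
    (ht : t ∈ postPeriods T₁) :
    iIndepFun (fun (p : ℕ × Bool) ω => M.splitShock T₀ t p.1 p.2 ω) P := by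
  have htT := le_of_mem_postPeriods ht
  refine iIndepFun_uncurry' (fun i b => h.measurable_splitShock T₀ htT i b) ?_ fun i => ?_
  · let g : ({t : ℤ // t ≤ T₁} → ℝ) → Bool → ℤ → ℝ := fun x b s =>
      if b then if hs : s ∈ prePeriods T₀ then x ⟨s, le_of_mem_prePeriods hs T₁⟩ else 0
      else x ⟨t, htT⟩
    have hg : Measurable g := by
      refine measurable_pi_lambda _ fun b => measurable_pi_lambda _ fun s => ?_
      cases b
      · simp only [g, Bool.false_eq_true, if_false]
        fun_prop
      · by_cases hs : s ∈ prePeriods T₀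
        · simp only [g, hs, if_true, dif_pos]
          fun_prop
        · simp only [g, hs, if_true, dif_neg, not_false_eq_true]
          fun_prop
    have h1 := h.indep_units.comp (fun _ => g) fun _ => hg
    refine h1.congr fun i => Eventually.of_forall fun ω => ?_
    funext b s
    cases b <;> simp [g, splitShock]
  · refine IndepFun.iIndepFun_bool ?_
    let g : ({s : ℤ // s ∈ prePeriods T₀} → ℝ) → ℤ → ℝ := fun x s =>
      if hs : s ∈ prePeriods T₀ then x ⟨s, hs⟩ else 0
    have hg : Measurable g := by
      refine measurable_pi_lambda _ fun s => ?_
      by_cases hs : s ∈ prePeriods T₀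
      · simp only [g, hs, dif_pos]
        fun_prop
      · simp only [g, hs, dif_neg, not_false_eq_true]
        fun_prop
    have hg' : Measurable fun (y : ℝ) (_ : ℤ) => y := measurable_pi_lambda _ fun _ => measurable_id
    have h2 := ((hpost i t ht T₀).comp hg' hg).symm
    have htrue : M.splitShock T₀ t i true = g ∘ fun ω s => M.shock i s ω := by
      funext ω s
      simp [g, splitShock]
    have hfalse : M.splitShock T₀ t i false = (fun (y : ℝ) (_ : ℤ) => y) ∘ M.shock i t := by
      funext ω s
      simp [splitShock]
    rw [htrue, hfalse]
    exact h2

section Outcomes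

variable {F : ℕ} {Ω : Type*}

theorem outcome_of_untreated (M : FactorModel F Ω) {i : ℕ} {t : ℤ} (h : i ≠ 0 ∨ t ≤ 0) (ω : Ω) :
    M.outcome i t ω = (∑ f, M.factor t f * M.load i f) + M.shock i t ω := by
  have h' : ¬ (i = 0 ∧ 0 < t) := by
    rintro ⟨h1, h2⟩
    rcases h with h | h
    · exact h h1
    · omega
  simp [outcome, treated, h', outcomeN]

theorem outcome_zero_of_pos (M : FactorModel F Ω) {t : ℤ} (ht : 0 < t) (ω : Ω) :
    M.outcome 0 t ω = M.effect 0 t + ((∑ f, M.factor t f * M.load 0 f) + M.shock 0 t ω) := by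
  simp [outcome, treated, ht, outcomeI, outcomeN]

/-- The pre-treatment observations are functions of the pre-treatment shocks. -/
theorem preData_le (M : FactorModel F Ω) (T₀ J : ℕ) (t : ℤ) :
    M.preData T₀ J ≤ MeasurableSpace.comap
      (fun ω (p : (Finset.range (J + 1) ×ˢ {true} : Finset (ℕ × Bool))) =>
        M.splitShock T₀ t p.1.1 p.1.2 ω) inferInstance := by
  refine iSup_le fun i => iSup₂_le fun s hs => ?_
  have hs0 : s ≤ 0 := (Finset.mem_Ioc.1 hs).2
  let p : (Finset.range (J + 1) ×ˢ {true} : Finset (ℕ × Bool)) :=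
    ⟨⟨i, true⟩, Finset.mem_product.2 ⟨Finset.mem_range.2 i.2, Finset.mem_singleton_self _⟩⟩
  rw [← measurable_iff_comap_le]
  have heq : M.outcome i s =
      (fun x : (Finset.range (J + 1) ×ˢ {true} : Finset (ℕ × Bool)) → ℤ → ℝ =>
        (∑ f, M.factor s f * M.load i f) + x p s) ∘
      fun ω p => M.splitShock T₀ t p.1.1 p.1.2 ω := by
    funext ω
    rw [M.outcome_of_untreated (Or.inr hs0)]
    simp [p, splitShock, hs]
  rw [heq]
  refine Measurable.comp ?_ (comap_measurable _)
  exact measurable_const.add ((measurable_pi_apply s).comp (measurable_pi_apply p))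

end Outcomes

/-- The weights, being functions of the pre-treatment observations, are independent of the
post-treatment shocks of any two units. -/
theorem ShockConditions.indepFun_weights [IsProbabilityMeasure P]
    (h : M.ShockConditions P T₁) (hpost : M.PostIndependentOfPre P T₁) (T₀ J : ℕ) {t : ℤ}
    (ht : t ∈ postPeriods T₁) {v : Ω → Fin J → ℝ} (hv : Measurable[M.preData T₀ J] v) (i j : ℕ) :
    IndepFun v (fun ω => (M.shock i t ω, M.shock j t ω)) P := by
  have htT := le_of_mem_postPeriods ht
  let T : Finset (ℕ × Bool) := {⟨i, false⟩, ⟨j, false⟩}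
  have hdisj : Disjoint (Finset.range (J + 1) ×ˢ {true} : Finset (ℕ × Bool)) T := by
    rw [Finset.disjoint_left]
    rintro ⟨k, b⟩ hk hk'
    have hb : b = true := by simpa using (Finset.mem_product.1 hk).2
    simp [T, hb] at hk'
  have hind := (h.iIndepFun_splitShock hpost T₀ ht).indepFun_finset _ T hdisj
    fun p => h.measurable_splitShock T₀ htT p.1 p.2
  let gi : T := ⟨⟨i, false⟩, by simp [T]⟩
  let gj : T := ⟨⟨j, false⟩, by simp [T]⟩
  have hind2 := hind.comp measurable_id
    (ψ := fun x : T → ℤ → ℝ => (x gi 0, x gj 0)) (by fun_prop)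
  rw [IndepFun_iff_Indep] at hind2 ⊢
  refine indep_of_indep_of_le_left hind2 ?_
  exact (measurable_iff_comap_le.1 hv).trans (M.preData_le T₀ J t)

theorem ShockConditions.preData_le (h : M.ShockConditions P T₁) (T₀ J : ℕ) :
    M.preData T₀ J ≤ ‹MeasurableSpace Ω› := by
  refine iSup_le fun i => iSup₂_le fun s hs => ?_
  rw [← measurable_iff_comap_le]
  have heq : M.outcome i s = fun ω => (∑ f, M.factor s f * M.load i f) + M.shock i s ω :=
    funext fun ω => M.outcome_of_untreated (Or.inr (Finset.mem_Ioc.1 hs).2) ω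
  rw [heq]
  exact measurable_const.add (h.measurable i s (le_of_mem_prePeriods hs T₁))

theorem ShockConditions.indepFun_shock (h : M.ShockConditions P T₁) {t : ℤ} (ht : t ≤ T₁)
    {i j : ℕ} (hij : i ≠ j) : IndepFun (M.shock i t) (M.shock j t) P :=
  (h.indep_units.indepFun hij).comp
    (φ := fun x : {t : ℤ // t ≤ T₁} → ℝ => x ⟨t, ht⟩)
    (ψ := fun x : {t : ℤ // t ≤ T₁} → ℝ => x ⟨t, ht⟩)
    (measurable_pi_apply _) (measurable_pi_apply _)

theorem ShockConditions.memLp_shock (h : M.ShockConditions P T₁) [IsProbabilityMeasure P] (i : ℕ)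
    {t : ℤ} (ht : t ≤ T₁) : MemLp (M.shock i t) 2 P := by
  obtain ⟨C, hC⟩ := h.fourth_moments
  rw [memLp_two_iff_integrable_sq (h.measurable i t ht).aestronglyMeasurable]
  refine Integrable.mono' ((integrable_const 1).add (hC i t ht).1)
    ((h.measurable i t ht).pow_const 2).aestronglyMeasurable (Eventually.of_forall fun ω => ?_)
  simp only [Pi.add_apply]
  rw [Real.norm_eq_abs, abs_of_nonneg (sq_nonneg _)]
  nlinarith [sq_nonneg (M.shock i t ω ^ 2 - 1), sq_nonneg (M.shock i t ω ^ 2)]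

theorem ShockConditions.exists_second_moment_le (h : M.ShockConditions P T₁)
    [IsProbabilityMeasure P] : ∃ C : ℝ, 0 ≤ C ∧ ∀ i : ℕ, ∀ t : ℤ, t ≤ T₁ →
      ∫ ω, M.shock i t ω ^ 2 ∂P ≤ C := by
  obtain ⟨C, hC⟩ := h.fourth_moments
  have hC' : ∀ i : ℕ, ∀ t : ℤ, t ≤ T₁ → ∫ ω, M.shock i t ω ^ 2 ∂P ≤ 1 + C := by
    intro i t ht
    calc ∫ ω, M.shock i t ω ^ 2 ∂P ≤ ∫ ω, (1 + M.shock i t ω ^ 4) ∂P := by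
          refine integral_mono (h.memLp_shock i ht).integrable_sq
            ((integrable_const 1).add (hC i t ht).1) fun ω => ?_
          simp only
          nlinarith [sq_nonneg (M.shock i t ω ^ 2 - 1), sq_nonneg (M.shock i t ω ^ 2)]
      _ ≤ 1 + C := by
          rw [integral_add (integrable_const 1) (hC i t ht).1]
          simpa using (hC i t ht).2
  refine ⟨1 + C, ?_, hC'⟩
  exact (integral_nonneg fun ω => sq_nonneg _).trans (hC' 0 0 (Int.natCast_nonneg T₁))

end FactorModel

/-! ### The fitted weights are diluted and balance the loadings -/

namespace FactorModel

section Comparison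

variable {F : ℕ} {Ω : Type*}

/-- The loadings of the treated unit minus those of the weighted average of the controls. -/
noncomputable def loadGap (M : FactorModel F Ω) {J : ℕ} (w : Fin J → ℝ) (f : Fin F) : ℝ :=
  M.load 0 f - ∑ j, w j * M.load ((j : ℕ) + 1) f

theorem syntheticLoad_apply (M : FactorModel F Ω) {J : ℕ} (w : Fin J → ℝ) (f : Fin F) :
    M.syntheticLoad w f = ∑ j, w j * M.load ((j : ℕ) + 1) f := by
  simp [syntheticLoad]

theorem sum_loadGap_sq (M : FactorModel F Ω) {J : ℕ} (w : Fin J → ℝ) :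
    ∑ f, M.loadGap w f ^ 2 = ‖M.syntheticLoad w - M.load 0‖ ^ 2 := by
  rw [norm_sub_rev, EuclideanSpace.norm_sq_eq]
  simp [loadGap, syntheticLoad_apply]

theorem abs_loadGap_le (M : FactorModel F Ω) {C : ℝ} (hC : ∀ i, ‖M.load i‖ ≤ C) {J : ℕ}
    {w : Fin J → ℝ} (hw : w ∈ stdSimplex ℝ (Fin J)) (f : Fin F) : |M.loadGap w f| ≤ 2 * C := by
  have hcoord : ∀ i, |M.load i f| ≤ C := fun i => (PiLp.norm_apply_le (M.load i) f).trans (hC i)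
  have h1 : |∑ j, w j * M.load ((j : ℕ) + 1) f| ≤ C := abs_sum_simplex_mul_le hw fun j => hcoord _
  calc |M.loadGap w f| ≤ |M.load 0 f| + |∑ j, w j * M.load ((j : ℕ) + 1) f| := abs_sub _ _
    _ ≤ 2 * C := by linarith [hcoord 0]

theorem synthetic_eq (M : FactorModel F Ω) {J : ℕ} (w : Fin J → ℝ) (t : ℤ) (ω : Ω) :
    M.synthetic w t ω = ∑ f, (∑ j, w j * M.load ((j : ℕ) + 1) f) * M.factor t f
      + ∑ j, w j * M.shock ((j : ℕ) + 1) t ω := by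
  have h1 : ∀ j : Fin J, w j * M.outcome ((j : ℕ) + 1) t ω
      = ∑ f, w j * M.load ((j : ℕ) + 1) f * M.factor t f + w j * M.shock ((j : ℕ) + 1) t ω := by
    intro j
    rw [M.outcome_of_untreated (Or.inl (Nat.succ_ne_zero _)), mul_add, Finset.mul_sum]
    congr 1
    exact Finset.sum_congr rfl fun f _ => by ring
  simp only [synthetic, h1, Finset.sum_add_distrib, Finset.sum_mul]
  rw [Finset.sum_comm]

theorem sum_loadGap_mul_factor (M : FactorModel F Ω) {J : ℕ} (w : Fin J → ℝ) (t : ℤ) :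
    ∑ f, M.loadGap w f * M.factor t f = ∑ f, M.factor t f * M.load 0 f
      - ∑ f, (∑ j, w j * M.load ((j : ℕ) + 1) f) * M.factor t f := by
  rw [← Finset.sum_sub_distrib]
  exact Finset.sum_congr rfl fun f _ => by rw [loadGap]; ring

/-- The estimation error has two sources: the loadings that the weights fail to match, and the
post-treatment shocks of the controls. -/
theorem effectEstimator_sub (M : FactorModel F Ω) {J : ℕ} (w : Ω → Fin J → ℝ) {t : ℤ} (ht : 0 < t)
    (ω : Ω) : M.effectEstimator w t ω - (M.effect 0 t + M.shock 0 t ω)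
      = ∑ f, M.loadGap (w ω) f * M.factor t f - ∑ j, w ω j * M.shock ((j : ℕ) + 1) t ω := by
  rw [effectEstimator, M.outcome_zero_of_pos ht, synthetic_eq, sum_loadGap_mul_factor]
  ring

theorem objective_eq (M : FactorModel F Ω) (T₀ : ℕ) {J : ℕ} (w : Fin J → ℝ) (ω : Ω) :
    M.objective T₀ ω w = preMean T₀ fun t => (∑ f, M.loadGap w f * M.factor t f + M.shock 0 t ω
      - ∑ j, w j * M.shock ((j : ℕ) + 1) t ω) ^ 2 := by
  rw [objective, preMean]
  congr 1
  refine Finset.sum_congr rfl fun t ht => ?_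
  rw [M.outcome_of_untreated (Or.inr (Finset.mem_Ioc.1 ht).2), synthetic_eq, sum_loadGap_mul_factor]
  ring

/-- The largest cross average of the shock of the treated unit and that of a control. -/
noncomputable def treatedCross (M : FactorModel F Ω) (T₀ J : ℕ) (ω : Ω) : ℝ :=
  ⨆ j : Fin J, |preMean T₀ fun t => M.shock 0 t ω * M.shock ((j : ℕ) + 1) t ω|

/-- The largest cross average of the factor `f` and the shock of one of the units `0, …, J`. -/
noncomputable def factorCross (M : FactorModel F Ω) (T₀ J : ℕ) (f : Fin F) (ω : Ω) : ℝ :=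
  ⨆ j : Fin (J + 1), |preMean T₀ fun t => M.factor t f * M.shock j t ω|

/-- The largest cross average of the shocks of two different controls. -/
noncomputable def controlCross (M : FactorModel F Ω) (T₀ J : ℕ) (ω : Ω) : ℝ :=
  ⨆ p : {p : Fin J × Fin J // p.1 ≠ p.2},
    |preMean T₀ fun t => M.shock ((p.1.1 : ℕ) + 1) t ω * M.shock ((p.1.2 : ℕ) + 1) t ω|

/-- The part of the mean squared residual that depends on the weights, without the cross terms. -/
noncomputable def separated (M : FactorModel F Ω) (T₀ : ℕ) {J : ℕ} (ω : Ω) (w : Fin J → ℝ) : ℝ :=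
  (∑ f, ∑ g, M.loadGap w f * M.loadGap w g * preMean T₀ fun t => M.factor t f * M.factor t g)
    + ∑ j, w j ^ 2 * preMean T₀ fun t => M.shock ((j : ℕ) + 1) t ω ^ 2

/-- A minimizer of the objective over the simplex minimizes the separated objective up to twice the
error bound of the separation. -/
theorem separated_le_of_isMinOn (M : FactorModel F Ω) {C : ℝ} (hC : ∀ i, ‖M.load i‖ ≤ C)
    (T₀ : ℕ) {J : ℕ} {ω : Ω} {v w : Fin J → ℝ} (hv : v ∈ stdSimplex ℝ (Fin J))
    (hw : w ∈ stdSimplex ℝ (Fin J)) (hmin : IsMinOn (M.objective T₀ ω) (stdSimplex ℝ (Fin J)) v) :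
    M.separated T₀ ω v ≤ M.separated T₀ ω w
      + 2 * (4 * (F * (2 * C) * ∑ f, M.factorCross T₀ J f ω) + 2 * M.treatedCross T₀ J ω
        + M.controlCross T₀ J ω) := by
  have hfc : ∀ f, 0 ≤ M.factorCross T₀ J f ω := fun f => Real.iSup_nonneg fun _ => abs_nonneg _
  have hfac : ∀ (f : Fin F) (j : Fin (J + 1)),
      |preMean T₀ fun t => M.factor t f * M.shock j t ω| ≤ ∑ f, M.factorCross T₀ J f ω :=
    fun f j => (le_ciSup (f := fun j : Fin (J + 1) =>
        |preMean T₀ fun t => M.factor t f * M.shock j t ω|) (Set.finite_range _).bddAbove j).trans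
      (Finset.single_le_sum (f := fun f => M.factorCross T₀ J f ω) (fun f _ => hfc f)
        (Finset.mem_univ f))
  have key : ∀ u ∈ stdSimplex ℝ (Fin J), |M.objective T₀ ω u - (M.separated T₀ ω u
      + preMean T₀ fun t => M.shock 0 t ω ^ 2)|
      ≤ 4 * (F * (2 * C) * ∑ f, M.factorCross T₀ J f ω) + 2 * M.treatedCross T₀ J ω
        + M.controlCross T₀ J ω := by
    intro u hu
    have h := abs_preMean_residual_sq_sub_le T₀ (fun f t => M.factor t f) (fun t => M.shock 0 t ω)
      (fun (j : Fin J) t => M.shock ((j : ℕ) + 1) t ω) hu (M.loadGap u)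
      (D := 2 * C) (a := M.treatedCross T₀ J ω) (b := ∑ f, M.factorCross T₀ J f ω)
      (c := M.controlCross T₀ J ω) (fun f => M.abs_loadGap_le hC hu f)
      (Real.iSup_nonneg fun _ => abs_nonneg _)
      (fun j => le_ciSup (f := fun j : Fin J =>
        |preMean T₀ fun t => M.shock 0 t ω * M.shock ((j : ℕ) + 1) t ω|)
        (Set.finite_range _).bddAbove j)
      (fun f => by simpa using hfac f 0)
      (fun f j => by simpa using hfac f j.succ)
      (fun i j hij => le_ciSup (f := fun p : {p : Fin J × Fin J // p.1 ≠ p.2} =>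
        |preMean T₀ fun t => M.shock ((p.1.1 : ℕ) + 1) t ω * M.shock ((p.1.2 : ℕ) + 1) t ω|)
        (Set.finite_range _).bddAbove ⟨(i, j), hij⟩)
    rw [← objective_eq, preMean_factor_sq, Fintype.card_fin] at h
    refine le_trans (le_of_eq ?_) h
    rw [separated]
    congr 1
    ring
  have h1 := abs_le.1 (key v hv)
  have h2 := abs_le.1 (key w hw)
  have h3 : M.objective T₀ ω v ≤ M.objective T₀ ω w := hmin hw
  linarith [h1.1, h2.2]

/-- How far the weights are from being diluted and from balancing the loadings. -/
noncomputable def imbalance (M : FactorModel F Ω) {J : ℕ} (w : Fin J → ℝ) : ℝ :=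
  ∑ f, M.loadGap w f ^ 2 + ∑ j, w j ^ 2

theorem imbalance_nonneg (M : FactorModel F Ω) {J : ℕ} (w : Fin J → ℝ) : 0 ≤ M.imbalance w :=
  add_nonneg (Finset.sum_nonneg fun _ _ => sq_nonneg _) (Finset.sum_nonneg fun _ _ => sq_nonneg _)

theorem imbalance_le (M : FactorModel F Ω) {C : ℝ} (hC : ∀ i, ‖M.load i‖ ≤ C) {J : ℕ}
    {w : Fin J → ℝ} (hw : w ∈ stdSimplex ℝ (Fin J)) : M.imbalance w ≤ F * (2 * C) ^ 2 + 1 := by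
  refine add_le_add ?_ (sum_sq_le_one_of_mem_stdSimplex hw)
  calc ∑ f, M.loadGap w f ^ 2 ≤ ∑ _f : Fin F, (2 * C) ^ 2 := by
        refine Finset.sum_le_sum fun f _ => ?_
        have h := abs_le.1 (M.abs_loadGap_le hC hw f)
        exact sq_le_sq' h.1 h.2
    _ = F * (2 * C) ^ 2 := by simp

theorem measurable_loadGap (M : FactorModel F Ω) {J : ℕ} (f : Fin F) :
    Measurable fun w : Fin J → ℝ => M.loadGap w f := by
  unfold loadGap
  fun_prop

theorem measurable_imbalance (M : FactorModel F Ω) {J : ℕ} :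
    Measurable fun w : Fin J → ℝ => M.imbalance w := by
  unfold imbalance loadGap
  fun_prop

end Comparison

variable {F : ℕ} {Ω : Type*} [MeasurableSpace Ω] {P : Measure Ω} {M : FactorModel F Ω} {T₁ : ℕ}

theorem ShockConditions.integrable_preMean_shock_sq [IsProbabilityMeasure P]
    (h : M.ShockConditions P T₁) (T₀ i : ℕ) :
    Integrable (fun ω => preMean T₀ fun t => M.shock i t ω ^ 2) P :=
  (integrable_finsetSum _ fun _ ht =>
    (h.memLp_shock i (le_of_mem_prePeriods ht T₁)).integrable_sq).const_mul _

/-- Diluted fixed weights make the weighted sum of mean squared shocks vanish in the limit. -/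
theorem ShockConditions.tendstoInMeasure_diluted [IsProbabilityMeasure P]
    (h : M.ShockConditions P T₁) {J : ℕ → ℕ} {w : (T₀ : ℕ) → Fin (J T₀) → ℝ}
    (hw : Tendsto (fun T₀ => √(∑ j, w T₀ j ^ 2)) atTop (𝓝 0)) :
    TendstoInMeasure P (fun T₀ ω => ∑ j, w T₀ j ^ 2 *
      preMean T₀ fun t => M.shock ((j : ℕ) + 1) t ω ^ 2) atTop (fun _ => 0) := by
  obtain ⟨C, hC0, hC⟩ := h.exists_second_moment_le
  have hint : ∀ T₀, ∀ j : Fin (J T₀), Integrable (fun ω => w T₀ j ^ 2 *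
      preMean T₀ fun t => M.shock ((j : ℕ) + 1) t ω ^ 2) P :=
    fun T₀ j => (h.integrable_preMean_shock_sq T₀ _).const_mul _
  have hnn : ∀ T₀ ω, 0 ≤ ∑ j, w T₀ j ^ 2 *
      preMean T₀ fun t => M.shock ((j : ℕ) + 1) t ω ^ 2 := fun T₀ ω =>
    Finset.sum_nonneg fun j _ => mul_nonneg (sq_nonneg _)
      (mul_nonneg (by positivity) (Finset.sum_nonneg fun _ _ => sq_nonneg _))
  refine tendstoInMeasure_zero_of_integral hnn (fun T₀ => integrable_finsetSum _ fun j _ => hint T₀ j)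
    ?_
  have hsq : Tendsto (fun T₀ => C * ∑ j, w T₀ j ^ 2) atTop (𝓝 0) := by
    have h2 := (hw.pow 2).const_mul C
    simp only [Real.sq_sqrt (Finset.sum_nonneg fun _ _ => sq_nonneg _)] at h2
    simpa using h2
  refine tendsto_of_tendsto_of_tendsto_of_le_of_le tendsto_const_nhds hsq
    (fun T₀ => integral_nonneg (hnn T₀)) fun T₀ => ?_
  simp only
  rw [integral_finsetSum _ fun j _ => hint T₀ j, Finset.mul_sum]
  refine Finset.sum_le_sum fun j _ => ?_
  rw [integral_const_mul, mul_comm]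
  refine mul_le_mul_of_nonneg_right ?_ (sq_nonneg _)
  have hswap : ∫ ω, preMean T₀ (fun t => M.shock ((j : ℕ) + 1) t ω ^ 2) ∂P
      = preMean T₀ fun t => ∫ ω, M.shock ((j : ℕ) + 1) t ω ^ 2 ∂P := by
    simp only [preMean]
    rw [integral_const_mul, integral_finsetSum _ fun t ht =>
      (h.memLp_shock _ (le_of_mem_prePeriods ht T₁)).integrable_sq]
  rw [hswap]
  exact preMean_le_of_le hC0 fun t ht => hC _ t (le_of_mem_prePeriods ht T₁)

/-- The complement form of the lower bound on the second moments of the controls. Since the condition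
is a limit of probabilities equal to `1`, this needs measurability of the events. -/
theorem TechnicalConditions.exists_tendsto_measure_not_le {J : ℕ → ℕ} [IsProbabilityMeasure P]
    (h : M.ShockConditions P T₁) (htech : M.TechnicalConditions P J) :
    ∃ c : ℝ, 0 < c ∧ Tendsto (fun T₀ : ℕ => P {ω | ¬ ∀ j : Fin (J T₀),
      c * T₀ ≤ ∑ t ∈ prePeriods T₀, M.shock ((j : ℕ) + 1) t ω ^ 2}) atTop (𝓝 0) := by
  obtain ⟨c, hc, hlim⟩ := htech.second_moment_lower
  refine ⟨c, hc, ?_⟩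
  simp only [abs_sq] at hlim
  have hmeas : ∀ T₀ : ℕ, MeasurableSet {ω | ∀ j : Fin (J T₀),
      c * T₀ ≤ ∑ t ∈ prePeriods T₀, M.shock ((j : ℕ) + 1) t ω ^ 2} := by
    intro T₀
    rw [Set.ofPred_forall]
    exact MeasurableSet.iInter fun j => measurableSet_le measurable_const
      (Finset.measurable_sum _ fun t ht =>
        (h.measurable _ t (le_of_mem_prePeriods ht T₁)).pow_const 2)
  have h1 := ENNReal.Tendsto.sub (tendsto_const_nhds (x := (1 : ENNReal)) (f := atTop)) hlim
    (Or.inl ENNReal.one_ne_top)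
  rw [tsub_self] at h1
  exact h1.congr fun T₀ => (prob_compl_eq_one_sub (hmeas T₀)).symm

/-- The synthetic control weights balance the loadings and are diluted in the limit. -/
theorem tendstoInMeasure_imbalance [IsProbabilityMeasure P] {J : ℕ → ℕ}
    (hshock : M.ShockConditions P T₁) (hload : M.LoadingConditions J)
    (hfactor : M.FactorConditions) (htech : M.TechnicalConditions P J)
    {w : (T₀ : ℕ) → Ω → Fin (J T₀) → ℝ} (hw : ∀ T₀, M.IsSCWeights P T₀ (J T₀) (w T₀)) :
    TendstoInMeasure P (fun T₀ ω => M.imbalance (w T₀ ω)) atTop (fun _ => 0) := by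
  obtain ⟨v, hv, hbal, hdil⟩ := hload.balancing
  obtain ⟨C, hC⟩ := hload.bounded
  obtain ⟨V, hV, hVlim⟩ := hfactor
  obtain ⟨k, K, hk, hK, hquad⟩ := hV.eventually_quadratic_bounds hVlim
  have hentry : ∀ (T₀ : ℕ) (f g : Fin F), ((1 / (T₀ : ℝ)) • ∑ t ∈ prePeriods T₀,
      Matrix.of fun f g => M.factor t f * M.factor t g) f g
      = preMean T₀ fun t => M.factor t f * M.factor t g := by
    intro T₀ f g
    simp [preMean, Matrix.sum_apply]
  simp only [hentry] at hquad
  obtain ⟨c, hc, hlower⟩ := htech.exists_tendsto_measure_not_le hshock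
  -- the value of the balancing weights, plus the error of the separation
  let R : ℕ → Ω → ℝ := fun T₀ ω => K * ‖M.syntheticLoad (v T₀) - M.load 0‖ ^ 2
    + (∑ j, v T₀ j ^ 2 * preMean T₀ fun t => M.shock ((j : ℕ) + 1) t ω ^ 2)
    + 2 * (4 * (F * (2 * C) * ∑ f, M.factorCross T₀ (J T₀) f ω)
      + 2 * M.treatedCross T₀ (J T₀) ω + M.controlCross T₀ (J T₀) ω)
  have hR : TendstoInMeasure P R atTop (fun _ => 0) := by
    refine tendstoInMeasure_zero_add (tendstoInMeasure_zero_add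
      (tendstoInMeasure_zero_of_const ?_) (hshock.tendstoInMeasure_diluted hdil))
      (tendstoInMeasure_zero_const_mul 2 (tendstoInMeasure_zero_add (tendstoInMeasure_zero_add
        (tendstoInMeasure_zero_const_mul 4 (tendstoInMeasure_zero_const_mul _
          (tendstoInMeasure_zero_sum _ fun f _ => htech.factor_shock f)))
        (tendstoInMeasure_zero_const_mul 2 htech.treated_control)) htech.control_control))
    simpa using (hbal.pow 2).const_mul K
  have hkc : 0 < min k c := lt_min hk hc
  let B : ℕ → Set Ω := fun T₀ => {ω | ¬ ∀ j : Fin (J T₀),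
      c * T₀ ≤ ∑ t ∈ prePeriods T₀, M.shock ((j : ℕ) + 1) t ω ^ 2} ∪
    {ω | ¬ (w T₀ ω ∈ stdSimplex ℝ (Fin (J T₀)) ∧
      IsMinOn (M.objective T₀ ω) (stdSimplex ℝ (Fin (J T₀))) (w T₀ ω))}
  have hB : Tendsto (fun T₀ => P (B T₀)) atTop (𝓝 0) := by
    refine tendsto_of_tendsto_of_tendsto_of_le_of_le tendsto_const_nhds hlower
      (fun _ => zero_le) fun T₀ => ?_
    have hnull : P {ω | ¬ (w T₀ ω ∈ stdSimplex ℝ (Fin (J T₀)) ∧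
        IsMinOn (M.objective T₀ ω) (stdSimplex ℝ (Fin (J T₀))) (w T₀ ω))} = 0 :=
      ae_iff.1 ((hw T₀).mem_simplex.and (hw T₀).isMinOn)
    refine (measure_union_le _ _).trans_eq ?_
    rw [hnull, add_zero]
  refine tendstoInMeasure_zero_of_le (tendstoInMeasure_zero_const_mul (min k c)⁻¹ hR) hB ?_
  filter_upwards [hquad, eventually_gt_atTop 0] with T₀ hq hT ω hω
  simp only [B, Set.mem_union, Set.mem_ofPred_eq, not_or, not_not] at hω
  obtain ⟨hlow, hmem, hmin⟩ := hω
  have hT' : (0 : ℝ) < T₀ := by exact_mod_cast hT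
  have hsep := M.separated_le_of_isMinOn hC T₀ hmem (hv T₀) hmin
  have hm : ∀ j : Fin (J T₀), c ≤ preMean T₀ fun t => M.shock ((j : ℕ) + 1) t ω ^ 2 := by
    intro j
    rw [preMean, one_div, le_inv_mul_iff₀ hT', mul_comm]
    exact hlow j
  have h1 : min k c * M.imbalance (w T₀ ω) ≤ M.separated T₀ ω (w T₀ ω) := by
    rw [imbalance, mul_add, separated]
    refine add_le_add ((mul_le_mul_of_nonneg_right (min_le_left k c)
      (Finset.sum_nonneg fun _ _ => sq_nonneg _)).trans (hq _).1) ?_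
    rw [Finset.mul_sum]
    refine Finset.sum_le_sum fun j _ => ?_
    rw [mul_comm]
    exact mul_le_mul_of_nonneg_left ((min_le_right k c).trans (hm j)) (sq_nonneg _)
  have h2 : M.separated T₀ ω (v T₀) ≤ K * ‖M.syntheticLoad (v T₀) - M.load 0‖ ^ 2
      + ∑ j, v T₀ j ^ 2 * preMean T₀ fun t => M.shock ((j : ℕ) + 1) t ω ^ 2 := by
    rw [separated, ← sum_loadGap_sq]
    exact add_le_add (hq _).2 le_rfl
  have h3 : min k c * M.imbalance (w T₀ ω) ≤ R T₀ ω := by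
    simp only [R]
    linarith
  rw [abs_of_nonneg (M.imbalance_nonneg _)]
  refine le_trans ?_ (le_abs_self _)
  rw [le_inv_mul_iff₀ hkc]
  exact h3

theorem tendsto_integral_imbalance [IsProbabilityMeasure P] {J : ℕ → ℕ}
    (hshock : M.ShockConditions P T₁) (hload : M.LoadingConditions J)
    (hfactor : M.FactorConditions) (htech : M.TechnicalConditions P J)
    {w : (T₀ : ℕ) → Ω → Fin (J T₀) → ℝ} (hw : ∀ T₀, M.IsSCWeights P T₀ (J T₀) (w T₀)) :
    Tendsto (fun T₀ => ∫ ω, M.imbalance (w T₀ ω) ∂P) atTop (𝓝 0) := by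
  obtain ⟨C, hC⟩ := hload.bounded
  refine tendsto_integral_of_tendstoInMeasure_zero (K := F * (2 * C) ^ 2 + 1)
    (tendstoInMeasure_imbalance hshock hload hfactor htech hw) (fun T₀ => ?_)
    (fun T₀ ω => M.imbalance_nonneg _) fun T₀ => ?_
  · exact M.measurable_imbalance.comp
      ((hw T₀).measurable_preData.mono (hshock.preData_le _ _) le_rfl)
  · filter_upwards [(hw T₀).mem_simplex] with ω hω
    exact M.imbalance_le hC hω

/-! ### The estimation error -/

/-- The second moment of the estimation error is at most a multiple, not depending on the weights,
of the expected imbalance of the weights. -/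
theorem exists_integral_error_sq_le [IsProbabilityMeasure P] {C : ℝ}
    (hshock : M.ShockConditions P T₁) (hC : ∀ i, ‖M.load i‖ ≤ C)
    (hpost : M.PostIndependentOfPre P T₁) {t : ℤ} (ht : t ∈ postPeriods T₁) :
    ∃ K : ℝ, ∀ (T₀ J : ℕ) (w : Ω → Fin J → ℝ), M.IsSCWeights P T₀ J w →
      MemLp (fun ω => M.effectEstimator w t ω - (M.effect 0 t + M.shock 0 t ω)) 2 P ∧
      ∫ ω, (M.effectEstimator w t ω - (M.effect 0 t + M.shock 0 t ω)) ^ 2 ∂P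
        ≤ K * ∫ ω, M.imbalance (w ω) ∂P := by
  obtain ⟨S, hS0, hS⟩ := hshock.exists_second_moment_le
  have htT := le_of_mem_postPeriods ht
  have ht0 : 0 < t := (Finset.mem_Icc.1 ht).1
  set L : ℝ := ∑ f, M.factor t f ^ 2 with hL
  have hL0 : 0 ≤ L := Finset.sum_nonneg fun _ _ => sq_nonneg _
  refine ⟨2 * L + 2 * S, fun T₀ J w hw => ?_⟩
  have hwm : Measurable w := hw.measurable_preData.mono (hshock.preData_le _ _) le_rfl
  simp only [M.effectEstimator_sub w ht0]
  have hw1 : ∀ᵐ ω ∂P, ∀ j, |w ω j| ≤ 1 := by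
    filter_upwards [hw.mem_simplex] with ω hω j
    rw [abs_of_nonneg (hω.1 j), ← hω.2]
    exact Finset.single_le_sum (f := w ω) (fun i _ => hω.1 i) (Finset.mem_univ j)
  obtain ⟨hu, husq⟩ := integral_sum_mul_sq_le (Y := fun (j : Fin J) => M.shock ((j : ℕ) + 1) t)
    hwm hw1 (fun j => hshock.memLp_shock _ htT) (fun j => hshock.measurable _ t htT)
    (fun i j => hshock.indepFun_weights hpost T₀ J ht hw.measurable_preData _ _)
    (fun i j hij => by
      have hij' : (i : ℕ) + 1 ≠ (j : ℕ) + 1 := fun h => hij (Fin.ext (Nat.succ_injective h))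
      rw [(hshock.indepFun_shock htT hij').integral_fun_mul_eq_mul_integral
        (hshock.measurable _ t htT).aestronglyMeasurable
        (hshock.measurable _ t htT).aestronglyMeasurable, hshock.mean_zero _ t htT, zero_mul])
    (fun j => hS _ t htT)
  have hgap : ∀ f, MemLp (fun ω => M.loadGap (w ω) f) 2 P := fun f => by
    refine MemLp.of_bound ((M.measurable_loadGap f).comp hwm).aestronglyMeasurable (2 * C) ?_
    filter_upwards [hw.mem_simplex] with ω hω
    exact M.abs_loadGap_le hC hω f
  have hx : MemLp (fun ω => ∑ f, M.loadGap (w ω) f * M.factor t f) 2 P :=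
    memLp_finsetSum _ fun f _ => (hgap f).mul_const _
  refine ⟨hx.sub hu, ?_⟩
  have hgapsq : Integrable (fun ω => ∑ f, M.loadGap (w ω) f ^ 2) P :=
    integrable_finsetSum _ fun f _ => (hgap f).integrable_sq
  have hwsq : Integrable (fun ω => ∑ j, w ω j ^ 2) P := by
    refine integrable_finsetSum _ fun j _ => Integrable.of_bound
      (((measurable_pi_apply j).comp hwm).pow_const 2).aestronglyMeasurable 1 ?_
    filter_upwards [hw1] with ω hω
    rw [norm_pow]
    exact pow_le_one₀ (norm_nonneg _) (hω j)
  calc ∫ ω, (∑ f, M.loadGap (w ω) f * M.factor t f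
          - ∑ j, w ω j * M.shock ((j : ℕ) + 1) t ω) ^ 2 ∂P
      ≤ ∫ ω, (2 * L * ∑ f, M.loadGap (w ω) f ^ 2
          + 2 * (∑ j, w ω j * M.shock ((j : ℕ) + 1) t ω) ^ 2) ∂P := by
        refine integral_mono (hx.sub hu).integrable_sq
          ((hgapsq.const_mul _).add (hu.integrable_sq.const_mul _)) fun ω => ?_
        simp only
        have hcs := Finset.sum_mul_sq_le_sq_mul_sq Finset.univ (M.loadGap (w ω))
          (fun f => M.factor t f)
        nlinarith [sq_nonneg (∑ f, M.loadGap (w ω) f * M.factor t f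
          + ∑ j, w ω j * M.shock ((j : ℕ) + 1) t ω)]
    _ = 2 * L * ∫ ω, ∑ f, M.loadGap (w ω) f ^ 2 ∂P
          + 2 * ∫ ω, (∑ j, w ω j * M.shock ((j : ℕ) + 1) t ω) ^ 2 ∂P := by
        rw [integral_add (hgapsq.const_mul _) (hu.integrable_sq.const_mul _),
          integral_const_mul, integral_const_mul]
    _ ≤ (2 * L + 2 * S) * ∫ ω, M.imbalance (w ω) ∂P := by
        simp only [imbalance]
        rw [integral_add hgapsq hwsq]
        have h1 : 0 ≤ ∫ ω, ∑ f, M.loadGap (w ω) f ^ 2 ∂P :=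
          integral_nonneg fun ω => Finset.sum_nonneg fun _ _ => sq_nonneg _
        have h2 : 0 ≤ ∫ ω, ∑ j, w ω j ^ 2 ∂P :=
          integral_nonneg fun ω => Finset.sum_nonneg fun _ _ => sq_nonneg _
        nlinarith [mul_nonneg hL0 h2, mul_nonneg hS0 h1]

end FactorModel

theorem corollary1 {F : ℕ} {Ω : Type*} [MeasurableSpace Ω] (P : Measure Ω) [IsProbabilityMeasure P]
    (M : FactorModel F Ω) (T₁ : ℕ) (J : ℕ → ℕ) (hJ : ∀ T₀, 1 ≤ J T₀)
    (hshock : M.ShockConditions P T₁)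
    (hload : M.LoadingConditions J)
    (hfactor : M.FactorConditions)
    (htech : M.TechnicalConditions P J)
    (hpost : M.PostIndependentOfPre P T₁)
    (w : (T₀ : ℕ) → Ω → Fin (J T₀) → ℝ)
    (hw : ∀ T₀, M.IsSCWeights P T₀ (J T₀) (w T₀))
    (t : ℤ) (ht : t ∈ postPeriods T₁) :
    -- convergence in probability to the effect plus the shock of the treated unit
    TendstoInMeasure P (fun T₀ => M.effectEstimator (w T₀) t) atTop
      (fun ω => M.effect 0 t + M.shock 0 t ω) ∧
    -- asymptotic unbiasedness: of the limit, and of the expectations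
    ∫ ω, (M.effect 0 t + M.shock 0 t ω) ∂P = M.effect 0 t ∧
    (∀ T₀, Integrable (M.effectEstimator (w T₀) t) P) ∧
    Tendsto (fun T₀ => ∫ ω, M.effectEstimator (w T₀) t ω ∂P) atTop (𝓝 (M.effect 0 t)) := by
  have htT := FactorModel.le_of_mem_postPeriods ht
  obtain ⟨C, hC⟩ := hload.bounded
  obtain ⟨K, hK⟩ := FactorModel.exists_integral_error_sq_le hshock hC hpost ht
  have hmem := fun T₀ => (hK T₀ (J T₀) (w T₀) (hw T₀)).1
  have hlim : Tendsto (fun T₀ => ∫ ω, (M.effectEstimator (w T₀) t ω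
      - (M.effect 0 t + M.shock 0 t ω)) ^ 2 ∂P) atTop (𝓝 0) := by
    have h := (FactorModel.tendsto_integral_imbalance hshock hload hfactor htech hw).const_mul K
    rw [mul_zero] at h
    exact tendsto_of_tendsto_of_tendsto_of_le_of_le tendsto_const_nhds h
      (fun T₀ => integral_nonneg fun ω => sq_nonneg _)
      fun T₀ => (hK T₀ (J T₀) (w T₀) (hw T₀)).2
  have hshock_int : Integrable (M.shock 0 t) P := (hshock.memLp_shock 0 htT).integrable one_le_two
  have htarget : Integrable (fun ω => M.effect 0 t + M.shock 0 t ω) P :=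
    (integrable_const _).add hshock_int
  have hmean : ∫ ω, (M.effect 0 t + M.shock 0 t ω) ∂P = M.effect 0 t := by
    rw [integral_add (integrable_const _) hshock_int, hshock.mean_zero 0 t htT]
    simp
  have hint : ∀ T₀, Integrable (M.effectEstimator (w T₀) t) P := fun T₀ => by
    refine (((hmem T₀).integrable one_le_two).add htarget).congr (Eventually.of_forall fun ω => ?_)
    simp
  refine ⟨?_, hmean, hint, ?_⟩
  · have h := tendstoInMeasure_zero_of_tendsto_integral_sq hmem hlim
    rw [tendstoInMeasure_iff_norm] at h ⊢
    simpa only [sub_zero] using h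
  · have h := (tendsto_integral_of_tendsto_integral_sq hmem hlim).add_const (M.effect 0 t)
    rw [zero_add] at h
    refine h.congr fun T₀ => ?_
    rw [integral_sub (hint T₀) htarget, hmean, sub_add_cancel]
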